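/- All graphs are finite directed graphs, with loops allowed and without parallel edges. MSO formulae are built from vertex variables and vertex-set variables with the atoms $x=y$, $x\in X$ and $E(x,y)$ ("there is an edge from $x$ to $y$"), the connectives $\neg,\wedge$, and existential quantification over vertices and over sets of vertices; an MSO sentence is a formula without free variables. A tree decomposition of $G$ is a tree whose nodes $p$ carry bags $B(p)\subseteq V(G)$ such that every vertex lies in some bag, the two ends of every edge lie in a common bag, and $B(p)\cap B(r)\subseteq B(q)$ whenever $q$ is on the path from $p$ to $r$; its width is the size of its largest bag minus one, and the treewidth of $G$ is the minimal width of its tree decompositions. An $\ell$-biboundaried graph ($\ell$-graph) is a graph $G$ with two sequences, each of $\ell$ distinct vertices: the primary ports $P_1(G)$ and the secondary ports $P_2(G)$; a vertex may occur in both. For $\ell$-graphs $G,G'$, let $G\oplus G'$ be the disjoint union of $G$ and $G'$ in which, for every $i$, the $i$-th secondary port of $G$ is merged with the $i$-th primary port of $G'$, with $P_1(G\oplus G')=P_1(G)$ and $P_2(G\oplus G')=P_2(G')$. For a family $\Gamma=\{G_i\}_{i\in I}$ of $\ell$-graphs and a nonempty word over $I$, define $\Delta^\Gamma(w_1)=G_{w_1}$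 and $\Delta^\Gamma(w_1\dots w_n)=\Delta^\Gamma(w_1\dots w_{n-1})\oplus G_{w_n}$. **Proposition.** Let $\phi$ be an MSO sentence and $k\ge 0$ an integer. If $\phi$ has infinitely many pairwise nonisomorphic models of treewidth $k$, then there are an integer $\ell$ with $0\le\ell\leq k+1$ and a triple of $\ell$-graphs $\Gamma=\{G_1,G_2,G_3\}$ such that $P_1(G_1)\cap P_2(G_1)\neq V(G_1)$ (where $P_1(G_1)$ and $P_2(G_1)$ are regarded as sets) and $\Delta^\Gamma(2\cdot 1^n\cdot 3)$ is a model of $\phi$ for every integer $n\ge 0$. -/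

import Mathlib

/-! ### Finite directed graphs -/

/-- A finite directed graph; loops are allowed and there are no parallel edges
(the edges are a binary relation on the vertices). -/
structure FinDigraph where
  /-- the vertices -/
  V : Type
  [finite : Finite V]
  /-- the edges -/
  graph : Digraph V

attribute [instance] FinDigraph.finite

/-- Two finite digraphs are isomorphic. -/
def FinDigraph.Isomorphic (G H : FinDigraph) : Prop :=
  Nonempty (G.graph.Adj ≃r H.graph.Adj)

/-! ### Monadic second-order logic of digraphs -/

/-- MSO formulae over the signature with one binary relation symbol `E`, with `n` free vertex
variables (indexed by `Fin n`) and `m` free vertex-set variables (indexed by `Fin m`).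
A quantifier binds the variable with index `0` of its body. -/
inductive MSOFormula : ℕ → ℕ → Type
  /-- the atom `x = y` -/
  | eq {n m : ℕ} (x y : Fin n) : MSOFormula n m
  /-- the atom `x ∈ X` -/
  | mem {n m : ℕ} (x : Fin n) (X : Fin m) : MSOFormula n m
  /-- the atom `E(x, y)` -/
  | edge {n m : ℕ} (x y : Fin n) : MSOFormula n m
  /-- negation -/
  | neg {n m : ℕ} (φ : MSOFormula n m) : MSOFormula n m
  /-- conjunction -/
  | and {n m : ℕ} (φ ψ : MSOFormula n m) : MSOFormula n m
  /-- there is a vertex -/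
  | existsVertex {n m : ℕ} (φ : MSOFormula (n + 1) m) : MSOFormula n m
  /-- there is a set of vertices -/
  | existsSet {n m : ℕ} (φ : MSOFormula n (m + 1)) : MSOFormula n m

/-- Truth of an MSO formula in a digraph, under an assignment `v` of its vertex variables and an
assignment `S` of its set variables. -/
def MSOFormula.Realize {V : Type} (G : Digraph V) :
    {n m : ℕ} → MSOFormula n m → (Fin n → V) → (Fin m → Set V) → Prop
  | _, _, .eq x y, v, _ => v x = v y
  | _, _, .mem x X, v, S => v x ∈ S X
  | _, _, .edge x y, v, _ => G.Adj (v x) (v y)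
  | _, _, .neg φ, v, S => ¬ φ.Realize G v S
  | _, _, .and φ ψ, v, S => φ.Realize G v S ∧ ψ.Realize G v S
  | _, _, .existsVertex φ, v, S => ∃ x : V, φ.Realize G (Fin.cons x v : Fin _ → V) S
  | _, _, .existsSet φ, v, S => ∃ X : Set V, φ.Realize G v (Fin.cons X S : Fin _ → Set V)

/-- An MSO sentence: a formula without free variables. -/
abbrev MSOSentence : Type := MSOFormula 0 0

/-- `G` is a model of the sentence `φ`. -/
def FinDigraph.Models (G : FinDigraph) (φ : MSOSentence) : Prop :=
  φ.Realize G.graph Fin.elim0 Fin.elim0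

/-! ### Tree decompositions and treewidth -/

/-- A tree decomposition of a digraph. The tree is given without a root, since neither the three
conditions nor the width depend on the choice of one. -/
structure TreeDecomposition {V : Type} (G : Digraph V) where
  /-- the nodes of the tree -/
  Node : Type
  [fintypeNode : Fintype Node]
  /-- the tree -/
  tree : SimpleGraph Node
  isTree : tree.IsTree
  /-- the bags -/
  bag : Node → Finset V
  /-- every vertex belongs to some bag -/
  vertex_mem : ∀ v : V, ∃ p : Node, v ∈ bag p
  /-- both ends of every edge belong to some common bag -/
  edge_mem : ∀ u v : V, G.Adj u v → ∃ p : Node, u ∈ bag p ∧ v ∈ bag p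
  /-- if `q` is on the path from `p` to `r`, then `bag p ∩ bag r ⊆ bag q` -/
  path_mem : ∀ (p q r : Node) (w : tree.Walk p r), w.IsPath → q ∈ w.support →
    ∀ v : V, v ∈ bag p → v ∈ bag r → v ∈ bag q

attribute [instance] TreeDecomposition.fintypeNode

/-- The width of a tree decomposition: the size of its largest bag, minus one. -/
def TreeDecomposition.width {V : Type} {G : Digraph V} (D : TreeDecomposition G) : ℤ :=
  ((Finset.univ.sup fun p : D.Node => (D.bag p).card : ℕ) : ℤ) - 1

/-- `G` has treewidth `k`: the minimal width among all its tree decompositions is `k`. -/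
def FinDigraph.HasTreewidth (G : FinDigraph) (k : ℤ) : Prop :=
  IsLeast {w : ℤ | ∃ D : TreeDecomposition G.graph, D.width = w} k

/-- `φ` has infinitely many (pairwise nonisomorphic) models of treewidth `k`. -/
def InfinitelyManyModelsOfTreewidth (φ : MSOSentence) (k : ℤ) : Prop :=
  ∃ M : ℕ → FinDigraph,
    (∀ i, (M i).Models φ ∧ (M i).HasTreewidth k) ∧
    ∀ i j, i ≠ j → ¬ (M i).Isomorphic (M j)

/-! ### Biboundaried graphs and gluing -/

/-- An `ℓ`-biboundaried graph (`ℓ`-graph): a finite digraph with a sequence `P₁` of `ℓ` distinct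
primary ports and a sequence `P₂` of `ℓ` distinct secondary ports. A vertex may be both a primary
and a secondary port. -/
structure BiboundariedGraph (ℓ : ℕ) extends FinDigraph where
  /-- the primary ports -/
  P₁ : Fin ℓ ↪ V
  /-- the secondary ports -/
  P₂ : Fin ℓ ↪ V

namespace BiboundariedGraph

variable {ℓ : ℕ}

/-- The `i`-th secondary port of `G` is to be merged with the `i`-th primary port of `H`. -/
inductive Merge (G H : BiboundariedGraph ℓ) : G.V ⊕ H.V → G.V ⊕ H.V → Prop
  | port (i : Fin ℓ) : Merge G H (Sum.inl (G.P₂ i)) (Sum.inr (H.P₁ i))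

/-- The vertices of `G` glued to `H`: the quotient of the disjoint union of the vertex sets by the
equivalence relation that `Merge` generates. -/
def GlueVertex (G H : BiboundariedGraph ℓ) : Type := Quot (Merge G H)

instance (G H : BiboundariedGraph ℓ) : Finite (GlueVertex G H) :=
  inferInstanceAs (Finite (Quot (Merge G H)))

/-- The vertex of the glued graph given by a vertex of the left graph. -/
def glueInl (G H : BiboundariedGraph ℓ) (a : G.V) : GlueVertex G H := Quot.mk _ (Sum.inl a)

/-- The vertex of the glued graph given by a vertex of the right graph. -/
def glueInr (G H : BiboundariedGraph ℓ) (b : H.V) : GlueVertex G H := Quot.mk _ (Sum.inr b)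

theorem glueInl_injective (G H : BiboundariedGraph ℓ) : Function.Injective (glueInl G H) := by
  intro a a' h
  let f : G.V ⊕ H.V → G.V ⊕ H.V :=
    Sum.elim Sum.inl (Function.extend H.P₁ (fun i => Sum.inl (G.P₂ i)) Sum.inr)
  have hf : ∀ x y, Merge G H x y → f x = f y := by
    rintro _ _ ⟨i⟩
    exact (H.P₁.injective.extend_apply (fun i => Sum.inl (G.P₂ i)) Sum.inr i).symm
  exact Sum.inl_injective (congrArg (Quot.lift f hf) h)

theorem glueInr_injective (G H : BiboundariedGraph ℓ) : Function.Injective (glueInr G H) := by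
  intro b b' h
  let f : G.V ⊕ H.V → G.V ⊕ H.V :=
    Sum.elim (Function.extend G.P₂ (fun i => Sum.inr (H.P₁ i)) Sum.inl) Sum.inr
  have hf : ∀ x y, Merge G H x y → f x = f y := by
    rintro _ _ ⟨i⟩
    exact G.P₂.injective.extend_apply (fun i => Sum.inr (H.P₁ i)) Sum.inl i
  exact Sum.inr_injective (congrArg (Quot.lift f hf) h)

/-- The gluing `G ⊕ H`: the disjoint union of `G` and `H` in which the `i`-th secondary port of `G`
is merged with the `i`-th primary port of `H`, for every `i`. Its edges are the images of the edges
of `G` and of the edges of `H`. Its primary ports are those of `G`, its secondary ports those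
of `H`. -/
def glue (G H : BiboundariedGraph ℓ) : BiboundariedGraph ℓ where
  V := GlueVertex G H
  graph :=
    { Adj := fun x y =>
        (∃ a b, G.graph.Adj a b ∧ glueInl G H a = x ∧ glueInl G H b = y) ∨
        (∃ a b, H.graph.Adj a b ∧ glueInr G H a = x ∧ glueInr G H b = y) }
  P₁ := G.P₁.trans ⟨glueInl G H, glueInl_injective G H⟩
  P₂ := H.P₂.trans ⟨glueInr G H, glueInr_injective G H⟩

/-- `Delta Γ a w` is the graph obtained by gluing the `ℓ`-graphs of the family `Γ` along the
nonempty word `a · w` (first letter `a`, remaining letters `w`), from left to right. -/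
def Delta {I : Type} (Γ : I → BiboundariedGraph ℓ) (a : I) (w : List I) : BiboundariedGraph ℓ :=
  w.foldl (fun G i => G.glue (Γ i)) (Γ a)

theorem Delta_nil {I : Type} (Γ : I → BiboundariedGraph ℓ) (a : I) : Delta Γ a [] = Γ a := rfl

theorem Delta_append_singleton {I : Type} (Γ : I → BiboundariedGraph ℓ) (a : I) (w : List I)
    (b : I) : Delta Γ a (w ++ [b]) = (Delta Γ a w).glue (Γ b) := by
  simp [Delta]

end BiboundariedGraph

/-- The three letters that index a triple of graphs. -/
inductive PumpLetter : Type
  | one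
  | two
  | three

/-!
The idea is to cut a large model `M` of `φ` along a long nested chain of separations of order at
most `k + 1`, and to repeat the part between two cuts that `φ` cannot tell apart.

*Types.* With `q` the quantifier rank of `φ`, an `ℓ`-graph has a type of rank `q`
(`BiboundariedGraph.msoType`), defined by back-and-forth over vertex sets, a vertex being a
singleton. There are finitely many types of a given rank. The type decides `φ`
(`models_iff_of_msoType_eq`), and the type of a gluing `G ⊕ H`, for fixed `H`, depends only on the
type of `G` (`IsGluing.msoType_eq`): a set in the gluing is a pair of sets in `G` and `H` that agree
on the merged ports, and the atomic facts about it can be read off the two parts. Gluings are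
described by a predicate instead of the quotient, so that induced subgraphs of `M` on the two sides
of a separation are directly recognized as the parts of a gluing.

*Separations.* A tree decomposition of width `k` gives, for each node `p` and each union `X` of
components of the tree without `p`, a separation of order at most `k + 1` whose right side consists
of the vertices in the bags of `p` and `X`. Every such pair `(p, X)` with `X` nonempty contains a
smaller one with at least about half as many vertices (`IsBranch.exists_ssubset`); hence, in a large
graph, there is a long chain of separations whose right sides decrease strictly
(`TreeDecomposition.exists_chain_of_card_lt`).

*Pumping.* As `φ` has infinitely many models of treewidth `k`, it has such models of unbounded size.
In a chain longer than the number of pairs of an order and a type, two separations `(L, R)` and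
`(L', R')` have the same order and left sides of the same type. Then `L`, `R ∩ L'` and `R'` induce
the graphs `G₂`, `G₁` and `G₃` (`exists_pump`), and `G₁` has a vertex outside `L' ∩ R'` because
`R' ⊂ R`.
-/

/-! ### Monadic second-order types -/

/-- The atomic facts about `m` vertex sets of an `ℓ`-graph: which are nonempty, which have at most
one element, which are contained in which, between which there is an edge, and which secondary
ports they contain. Vertex variables are encoded by singletons. -/
abbrev AtomicType (ℓ m : ℕ) : Type :=
  (Fin m → Prop) × (Fin m → Prop) × (Fin m → Fin m → Prop) × (Fin m → Fin m → Prop) ×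
    (Fin m → Fin ℓ → Prop)

/-- The possible values of the type of quantifier rank `q` of `m` vertex sets in an `ℓ`-graph. -/
def MSOType (ℓ : ℕ) : ℕ → ℕ → Type
  | 0, m => AtomicType ℓ m
  | q + 1, m => AtomicType ℓ m × Set (MSOType ℓ q (m + 1))

instance MSOType.instFinite (ℓ : ℕ) : ∀ q m, Finite (MSOType ℓ q m)
  | 0, m => inferInstanceAs (Finite (AtomicType ℓ m))
  | q + 1, m =>
    have := MSOType.instFinite ℓ q (m + 1)
    inferInstanceAs (Finite (AtomicType ℓ m × Set (MSOType ℓ q (m + 1))))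

/-- The quantifier rank of a formula; both sorts of quantifiers count. -/
def MSOFormula.rank : {n m : ℕ} → MSOFormula n m → ℕ
  | _, _, .eq _ _ => 0
  | _, _, .mem _ _ => 0
  | _, _, .edge _ _ => 0
  | _, _, .neg φ => φ.rank
  | _, _, .and φ ψ => max φ.rank ψ.rank
  | _, _, .existsVertex φ => φ.rank + 1
  | _, _, .existsSet φ => φ.rank + 1

namespace BiboundariedGraph

variable {ℓ m : ℕ}

/-- The atomic type of a tuple of vertex sets; only the secondary ports are recorded. -/
def atomicType (G : BiboundariedGraph ℓ) (S : Fin m → Set G.V) : AtomicType ℓ m :=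
  (fun i => (S i).Nonempty, fun i => (S i).Subsingleton, fun i j => S i ⊆ S j,
    fun i j => ∃ x ∈ S i, ∃ y ∈ S j, G.graph.Adj x y, fun i a => G.P₂ a ∈ S i)

/-- The type of quantifier rank `q` of a tuple of vertex sets: its atomic type and, if `q > 0`, the
types of rank `q - 1` that arise by adding one more set. -/
def msoType (G : BiboundariedGraph ℓ) : (q : ℕ) → {m : ℕ} → (Fin m → Set G.V) → MSOType ℓ q m
  | 0, _, S => atomicType G S
  | q + 1, m, S =>
    (atomicType G S,
      Set.range fun X : Set G.V => msoType G q (Fin.cons X S : Fin (m + 1) → Set G.V))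

theorem atomicType_eq_iff {G G' : BiboundariedGraph ℓ} {S : Fin m → Set G.V}
    {S' : Fin m → Set G'.V} :
    atomicType G S = atomicType G' S' ↔
      (∀ i, (S i).Nonempty ↔ (S' i).Nonempty) ∧
      (∀ i, (S i).Subsingleton ↔ (S' i).Subsingleton) ∧
      (∀ i j, S i ⊆ S j ↔ S' i ⊆ S' j) ∧
      (∀ i j, (∃ x ∈ S i, ∃ y ∈ S j, G.graph.Adj x y) ↔
        ∃ x ∈ S' i, ∃ y ∈ S' j, G'.graph.Adj x y) ∧
      ∀ i a, G.P₂ a ∈ S i ↔ G'.P₂ a ∈ S' i := by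
  simp only [atomicType, Prod.mk.injEq, funext_iff, eq_iff_iff]

theorem atomicType_eq_of_msoType_eq {G G' : BiboundariedGraph ℓ} {q : ℕ} {S : Fin m → Set G.V}
    {S' : Fin m → Set G'.V} (h : msoType G q S = msoType G' q S') :
    atomicType G S = atomicType G' S' := by
  cases q with
  | zero => exact h
  | succ q => exact congrArg Prod.fst h

theorem exists_msoType_cons_eq {G G' : BiboundariedGraph ℓ} {q : ℕ} {S : Fin m → Set G.V}
    {S' : Fin m → Set G'.V} (h : msoType G (q + 1) S = msoType G' (q + 1) S') (X : Set G.V) :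
    ∃ X' : Set G'.V, msoType G q (Fin.cons X S : Fin (m + 1) → Set G.V) =
      msoType G' q (Fin.cons X' S' : Fin (m + 1) → Set G'.V) := by
  have h2 : (Set.range fun X : Set G.V => msoType G q (Fin.cons X S : Fin (m + 1) → Set G.V)) =
      Set.range fun X' : Set G'.V => msoType G' q (Fin.cons X' S' : Fin (m + 1) → Set G'.V) :=
    congrArg Prod.snd h
  have : msoType G q (Fin.cons X S : Fin (m + 1) → Set G.V) ∈
      Set.range fun X' : Set G'.V => msoType G' q (Fin.cons X' S' : Fin (m + 1) → Set G'.V) :=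
    h2.subset (Set.mem_range_self X)
  obtain ⟨X', hX'⟩ := this
  exact ⟨X', hX'.symm⟩

/-- The answer to a singleton is a singleton, so that vertex quantifiers need no separate moves. -/
theorem exists_eq_singleton {G G' : BiboundariedGraph ℓ} {q : ℕ} {S : Fin m → Set G.V}
    {S' : Fin m → Set G'.V} (h : msoType G q S = msoType G' q S') {i : Fin m} {x : G.V}
    (hx : S i = {x}) : ∃ x', S' i = {x'} := by
  obtain ⟨h1, h2, -⟩ := atomicType_eq_iff.1 (atomicType_eq_of_msoType_eq h)
  obtain ⟨x', hx'⟩ := (h1 i).1 (hx ▸ Set.singleton_nonempty x)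
  exact ⟨x', ((h2 i).1 (hx ▸ Set.subsingleton_singleton)).eq_singleton_of_mem hx'⟩

/-- The type of rank `q` decides the formulas of rank at most `q`. The maps `e` and `d` say which
entries of the tuple of sets encode the vertex variables and the set variables. -/
theorem realize_iff_of_msoType_eq {G G' : BiboundariedGraph ℓ} {n p : ℕ} (φ : MSOFormula n p)
    {q : ℕ} (hq : φ.rank ≤ q) {m : ℕ} {S : Fin m → Set G.V} {S' : Fin m → Set G'.V}
    (h : msoType G q S = msoType G' q S') (e : Fin n → Fin m) (d : Fin p → Fin m)
    {v : Fin n → G.V} {v' : Fin n → G'.V} (hv : ∀ x, S (e x) = {v x})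
    (hv' : ∀ x, S' (e x) = {v' x}) :
    φ.Realize G.graph v (fun X => S (d X)) ↔ φ.Realize G'.graph v' (fun X => S' (d X)) := by
  induction φ generalizing q m with
  | eq x y =>
    have := (atomicType_eq_iff.1 (atomicType_eq_of_msoType_eq h)).2.2.1 (e x) (e y)
    simpa [MSOFormula.Realize, hv, hv'] using this
  | mem x X =>
    have := (atomicType_eq_iff.1 (atomicType_eq_of_msoType_eq h)).2.2.1 (e x) (d X)
    simpa [MSOFormula.Realize, hv, hv'] using this
  | edge x y =>
    have := (atomicType_eq_iff.1 (atomicType_eq_of_msoType_eq h)).2.2.2.1 (e x) (e y)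
    simpa [MSOFormula.Realize, hv, hv'] using this
  | neg φ ih => exact not_congr (ih hq h e d hv hv')
  | and φ ψ ih₁ ih₂ =>
    exact and_congr (ih₁ (le_trans (le_max_left _ _) hq) h e d hv hv')
      (ih₂ (le_trans (le_max_right _ _) hq) h e d hv hv')
  | @existsVertex n p φ ih =>
    obtain ⟨q, rfl⟩ : ∃ r, q = r + 1 := ⟨q - 1, by simp only [MSOFormula.rank] at hq; omega⟩
    have hq' : φ.rank ≤ q := by simpa [MSOFormula.rank] using hq
    -- the two directions are instances of one symmetric claim
    have key : ∀ x x', msoType G q (Fin.cons {x} S : Fin (m + 1) → Set G.V) =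
        msoType G' q (Fin.cons {x'} S' : Fin (m + 1) → Set G'.V) →
        (φ.Realize G.graph (Fin.cons x v : Fin _ → G.V) (fun X => S (d X)) ↔
          φ.Realize G'.graph (Fin.cons x' v' : Fin _ → G'.V) (fun X => S' (d X))) := by
      intro x x' hxx
      have := ih hq' hxx (Fin.cons 0 (fun i => (e i).succ)) (fun X => (d X).succ)
        (v := Fin.cons x v) (v' := Fin.cons x' v')
        (fun i => by refine Fin.cases ?_ (fun i => ?_) i <;> simp [hv])
        (fun i => by refine Fin.cases ?_ (fun i => ?_) i <;> simp [hv'])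
      simpa only [Fin.cons_succ] using this
    constructor
    · rintro ⟨x, hx⟩
      obtain ⟨X', hX'⟩ := exists_msoType_cons_eq h {x}
      obtain ⟨x', hx'⟩ := exists_eq_singleton hX' (i := 0) (x := x) rfl
      obtain rfl : X' = {x'} := hx'
      exact ⟨x', (key x x' hX').1 hx⟩
    · rintro ⟨x', hx'⟩
      obtain ⟨X, hX⟩ := exists_msoType_cons_eq h.symm {x'}
      obtain ⟨x, hx⟩ := exists_eq_singleton hX (i := 0) (x := x') rfl
      obtain rfl : X = {x} := hx
      exact ⟨x, (key x x' hX.symm).2 hx'⟩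
  | @existsSet n p φ ih =>
    obtain ⟨q, rfl⟩ : ∃ r, q = r + 1 := ⟨q - 1, by simp only [MSOFormula.rank] at hq; omega⟩
    have hq' : φ.rank ≤ q := by simpa [MSOFormula.rank] using hq
    have cons_eq : ∀ {W : Type} (X : Set W) (T : Fin m → Set W),
        (fun Y => (Fin.cons X T : Fin (m + 1) → Set W)
          ((Fin.cons 0 fun i => (d i).succ : Fin (p + 1) → Fin (m + 1)) Y)) =
        (Fin.cons X fun Y => T (d Y) : Fin (p + 1) → Set W) := by
      intro W X T
      funext Y
      refine Fin.cases ?_ (fun i => ?_) Y <;> simp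
    have key : ∀ X X', msoType G q (Fin.cons X S : Fin (m + 1) → Set G.V) =
        msoType G' q (Fin.cons X' S' : Fin (m + 1) → Set G'.V) →
        (φ.Realize G.graph v (Fin.cons X (fun Y => S (d Y)) : Fin _ → Set G.V) ↔
          φ.Realize G'.graph v' (Fin.cons X' (fun Y => S' (d Y)) : Fin _ → Set G'.V)) := by
      intro X X' hXX
      have := ih hq' hXX (fun i => (e i).succ) (Fin.cons 0 fun i => (d i).succ)
        (v := v) (v' := v') (fun i => by simp [hv]) (fun i => by simp [hv'])
      rwa [cons_eq, cons_eq] at this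
    constructor
    · rintro ⟨X, hX⟩
      obtain ⟨X', hX'⟩ := exists_msoType_cons_eq h X
      exact ⟨X', (key X X' hX').1 hX⟩
    · rintro ⟨X', hX'⟩
      obtain ⟨X, hX⟩ := exists_msoType_cons_eq h.symm X'
      exact ⟨X, (key X X' hX.symm).2 hX'⟩

theorem models_iff_of_msoType_eq {G G' : BiboundariedGraph ℓ} (φ : MSOSentence)
    (h : msoType G φ.rank (Fin.elim0 : Fin 0 → Set G.V) =
      msoType G' φ.rank (Fin.elim0 : Fin 0 → Set G'.V)) :
    G.toFinDigraph.Models φ ↔ G'.toFinDigraph.Models φ := by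
  have := realize_iff_of_msoType_eq φ le_rfl h Fin.elim0 Fin.elim0 (v := Fin.elim0)
    (v' := Fin.elim0) (fun x => x.elim0) (fun x => x.elim0)
  unfold FinDigraph.Models
  convert this using 2

/-! ### Types of gluings -/

/-- `K` is a gluing of `G` and `H` by means of the maps `a` and `b`. This determines `K` up to
isomorphism, its primary ports aside. -/
structure IsGluing (G H K : BiboundariedGraph ℓ) (a : G.V → K.V) (b : H.V → K.V) : Prop where
  cover : ∀ z, (∃ x, a x = z) ∨ ∃ y, b y = z
  injective_left : Function.Injective a
  injective_right : Function.Injective b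
  eq_iff : ∀ x y, a x = b y ↔ ∃ i, x = G.P₂ i ∧ y = H.P₁ i
  adj_iff : ∀ z w, K.graph.Adj z w ↔ (∃ x y, G.graph.Adj x y ∧ a x = z ∧ a y = w) ∨
    ∃ x y, H.graph.Adj x y ∧ b x = z ∧ b y = w
  port : ∀ i, K.P₂ i = b (H.P₂ i)

theorem isGluing_glue (G H : BiboundariedGraph ℓ) :
    IsGluing G H (G.glue H) (glueInl G H) (glueInr G H) where
  cover z := by
    induction z using Quot.ind with
    | mk z =>
      obtain x | y := z
      exacts [.inl ⟨x, rfl⟩, .inr ⟨y, rfl⟩]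
  injective_left := glueInl_injective G H
  injective_right := glueInr_injective G H
  eq_iff x y := by
    constructor
    · intro h
      -- the retraction that sends each merged vertex to its copy in `G`
      let f : G.V ⊕ H.V → G.V ⊕ H.V :=
        Sum.elim Sum.inl (Function.extend H.P₁ (fun i => Sum.inl (G.P₂ i)) Sum.inr)
      have hf : ∀ x y, Merge G H x y → f x = f y := by
        rintro _ _ ⟨i⟩
        exact (H.P₁.injective.extend_apply (fun i => Sum.inl (G.P₂ i)) Sum.inr i).symm
      have h' : (Sum.inl x : G.V ⊕ H.V) =
          Function.extend H.P₁ (fun i => Sum.inl (G.P₂ i)) Sum.inr y :=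
        congrArg (Quot.lift f hf) h
      by_cases hy : ∃ i, H.P₁ i = y
      · obtain ⟨i, rfl⟩ := hy
        rw [H.P₁.injective.extend_apply] at h'
        exact ⟨i, Sum.inl_injective h', rfl⟩
      · rw [Function.extend_apply' _ _ _ hy] at h'
        cases h'
    · rintro ⟨i, rfl, rfl⟩
      exact Quot.sound (.port i)
  adj_iff _ _ := Iff.rfl
  port _ := rfl

namespace IsGluing

variable {G H K : BiboundariedGraph ℓ} {a : G.V → K.V} {b : H.V → K.V}

theorem nonempty_iff (h : IsGluing G H K a b) (X : Set K.V) :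
    X.Nonempty ↔ (a ⁻¹' X).Nonempty ∨ (b ⁻¹' X).Nonempty := by
  constructor
  · rintro ⟨z, hz⟩
    obtain ⟨x, rfl⟩ | ⟨y, rfl⟩ := h.cover z
    · exact .inl ⟨x, hz⟩
    · exact .inr ⟨y, hz⟩
  · rintro (⟨x, hx⟩ | ⟨y, hy⟩)
    exacts [⟨_, hx⟩, ⟨_, hy⟩]

theorem subset_iff (h : IsGluing G H K a b) (X Y : Set K.V) :
    X ⊆ Y ↔ a ⁻¹' X ⊆ a ⁻¹' Y ∧ b ⁻¹' X ⊆ b ⁻¹' Y := by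
  refine ⟨fun hXY => ⟨Set.preimage_mono hXY, Set.preimage_mono hXY⟩, fun ⟨h1, h2⟩ z hz => ?_⟩
  obtain ⟨x, rfl⟩ | ⟨y, rfl⟩ := h.cover z
  exacts [h1 hz, h2 hz]

theorem subsingleton_iff (h : IsGluing G H K a b) (X : Set K.V) :
    X.Subsingleton ↔ (a ⁻¹' X).Subsingleton ∧ (b ⁻¹' X).Subsingleton ∧
      ((a ⁻¹' X).Nonempty → (b ⁻¹' X).Nonempty →
        ∃ i, G.P₂ i ∈ a ⁻¹' X ∧ H.P₁ i ∈ b ⁻¹' X) := by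
  constructor
  · intro hX
    refine ⟨hX.preimage h.injective_left, hX.preimage h.injective_right, ?_⟩
    rintro ⟨x, hx⟩ ⟨y, hy⟩
    obtain ⟨i, rfl, rfl⟩ := (h.eq_iff x y).1 (hX hx hy)
    exact ⟨i, hx, hy⟩
  · rintro ⟨h1, h2, h3⟩
    have h4 : ∀ x y, a x ∈ X → b y ∈ X → a x = b y := by
      intro x y hx hy
      obtain ⟨i, hi, hi'⟩ := h3 ⟨x, hx⟩ ⟨y, hy⟩
      exact (h.eq_iff x y).2 ⟨i, h1 hx hi, h2 hy hi'⟩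
    intro z hz w hw
    obtain ⟨x, rfl⟩ | ⟨y, rfl⟩ := h.cover z <;> obtain ⟨x', rfl⟩ | ⟨y', rfl⟩ := h.cover w
    · exact congrArg a (h1 hz hw)
    · exact h4 _ _ hz hw
    · exact (h4 _ _ hw hz).symm
    · exact congrArg b (h2 hz hw)

theorem exists_adj_iff (h : IsGluing G H K a b) (X Y : Set K.V) :
    (∃ x ∈ X, ∃ y ∈ Y, K.graph.Adj x y) ↔
      (∃ x ∈ a ⁻¹' X, ∃ y ∈ a ⁻¹' Y, G.graph.Adj x y) ∨
      ∃ x ∈ b ⁻¹' X, ∃ y ∈ b ⁻¹' Y, H.graph.Adj x y := by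
  constructor
  · rintro ⟨z, hz, w, hw, hzw⟩
    obtain ⟨x, y, hxy, rfl, rfl⟩ | ⟨x, y, hxy, rfl, rfl⟩ := (h.adj_iff z w).1 hzw
    · exact .inl ⟨x, hz, y, hw, hxy⟩
    · exact .inr ⟨x, hz, y, hw, hxy⟩
  · rintro (⟨x, hx, y, hy, hxy⟩ | ⟨x, hx, y, hy, hxy⟩)
    · exact ⟨a x, hx, a y, hy, (h.adj_iff _ _).2 (.inl ⟨x, y, hxy, rfl, rfl⟩)⟩
    · exact ⟨b x, hx, b y, hy, (h.adj_iff _ _).2 (.inr ⟨x, y, hxy, rfl, rfl⟩)⟩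

/-- Subsets of the two parts that agree on the merged ports come from a subset of the gluing. -/
theorem exists_preimage_eq (h : IsGluing G H K a b) (X : Set G.V) (Y : Set H.V)
    (hXY : ∀ i, G.P₂ i ∈ X ↔ H.P₁ i ∈ Y) : ∃ Z : Set K.V, a ⁻¹' Z = X ∧ b ⁻¹' Z = Y := by
  refine ⟨a '' X ∪ b '' Y, ?_, ?_⟩
  · ext x
    constructor
    · rintro (⟨x', hx', hx⟩ | ⟨y, hy, hx⟩)
      · exact h.injective_left hx ▸ hx'
      · obtain ⟨i, rfl, rfl⟩ := (h.eq_iff x y).1 hx.symm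
        exact (hXY i).2 hy
    · exact fun hx => .inl ⟨x, hx, rfl⟩
  · ext y
    constructor
    · rintro (⟨x, hx, hy⟩ | ⟨y', hy', hy⟩)
      · obtain ⟨i, rfl, rfl⟩ := (h.eq_iff x y).1 hy
        exact (hXY i).1 hx
      · exact h.injective_right hy ▸ hy'
    · exact fun hy => .inr ⟨y, hy, rfl⟩

theorem preimage_port_iff (h : IsGluing G H K a b) (X : Set K.V) (i : Fin ℓ) :
    G.P₂ i ∈ a ⁻¹' X ↔ H.P₁ i ∈ b ⁻¹' X := by
  rw [Set.mem_preimage, Set.mem_preimage, (h.eq_iff _ _).2 ⟨i, rfl, rfl⟩]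

variable {G' K' : BiboundariedGraph ℓ} {a' : G'.V → K'.V} {b' : H.V → K'.V}

theorem atomicType_eq (h : IsGluing G H K a b) (h' : IsGluing G' H K' a' b')
    {X : Fin m → Set K.V} {X' : Fin m → Set K'.V}
    (ha : atomicType G (fun i => a ⁻¹' X i) = atomicType G' (fun i => a' ⁻¹' X' i))
    (hb : ∀ i, b ⁻¹' X i = b' ⁻¹' X' i) : atomicType K X = atomicType K' X' := by
  obtain ⟨h1, h2, h3, h4, h5⟩ := atomicType_eq_iff.1 ha
  refine atomicType_eq_iff.2 ⟨fun i => ?_, fun i => ?_, fun i j => ?_, fun i j => ?_,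
    fun i p => ?_⟩
  · rw [h.nonempty_iff, h'.nonempty_iff, h1, hb]
  · rw [h.subsingleton_iff, h'.subsingleton_iff, h1, h2, hb]
    simp only [h5]
  · rw [h.subset_iff, h'.subset_iff, h3, hb, hb]
  · rw [h.exists_adj_iff, h'.exists_adj_iff, h4, hb, hb]
  · rw [h.port, h'.port]
    exact Set.ext_iff.1 (hb i) (H.P₂ p)

theorem preimage_cons {W W' : Type} (f : W → W') (Y : Set W') (X : Fin m → Set W') :
    (fun i => f ⁻¹' (Fin.cons Y X : Fin (m + 1) → Set W') i) =
      (Fin.cons (f ⁻¹' Y) fun i => f ⁻¹' X i : Fin (m + 1) → Set W) := by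
  funext i
  refine Fin.cases ?_ (fun i => ?_) i <;> simp

/-- Gluing respects types: the type of a gluing depends on its left part only through the type of
that part. -/
theorem msoType_eq (q : ℕ) {m : ℕ} (h : IsGluing G H K a b) (h' : IsGluing G' H K' a' b')
    {X : Fin m → Set K.V} {X' : Fin m → Set K'.V}
    (ha : msoType G q (fun i => a ⁻¹' X i) = msoType G' q (fun i => a' ⁻¹' X' i))
    (hb : ∀ i, b ⁻¹' X i = b' ⁻¹' X' i) : msoType K q X = msoType K' q X' := by
  induction q generalizing m G G' K K' with
  | zero => exact h.atomicType_eq h' ha hb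
  | succ q ih =>
    have forth : ∀ {G K G' K' : BiboundariedGraph ℓ} {a : G.V → K.V} {b : H.V → K.V}
        {a' : G'.V → K'.V} {b' : H.V → K'.V} {X : Fin m → Set K.V} {X' : Fin m → Set K'.V},
        IsGluing G H K a b → IsGluing G' H K' a' b' →
        msoType G (q + 1) (fun i => a ⁻¹' X i) = msoType G' (q + 1) (fun i => a' ⁻¹' X' i) →
        (∀ i, b ⁻¹' X i = b' ⁻¹' X' i) →
        (Set.range fun Y : Set K.V => msoType K q (Fin.cons Y X : Fin (m + 1) → Set K.V)) ⊆
          Set.range fun Y : Set K'.V =>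
            msoType K' q (Fin.cons Y X' : Fin (m + 1) → Set K'.V) := by
      rintro G K G' K' a b a' b' X X' h h' ha hb _ ⟨Y, rfl⟩
      obtain ⟨Z, hZ⟩ := exists_msoType_cons_eq ha (a ⁻¹' Y)
      have hport := (atomicType_eq_iff.1 (atomicType_eq_of_msoType_eq hZ)).2.2.2.2 0
      obtain ⟨Y', rfl, hY'⟩ := h'.exists_preimage_eq Z (b ⁻¹' Y) fun i =>
        (hport i).symm.trans (h.preimage_port_iff Y i)
      refine ⟨Y', (ih h h' ?_ fun i => ?_).symm⟩
      · rw [preimage_cons, preimage_cons, hZ]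
      · refine Fin.cases ?_ (fun i => ?_) i
        · simpa using hY'.symm
        · simpa using hb i
    exact Prod.ext (h.atomicType_eq h' (congrArg Prod.fst ha) hb)
      (Set.Subset.antisymm (forth h h' ha hb) (forth h' h ha.symm fun i => (hb i).symm))

theorem msoType_elim0_eq {q : ℕ} (h : IsGluing G H K a b) (h' : IsGluing G' H K' a' b')
    (ha : msoType G q (Fin.elim0 : Fin 0 → Set G.V) =
      msoType G' q (Fin.elim0 : Fin 0 → Set G'.V)) :
    msoType K q (Fin.elim0 : Fin 0 → Set K.V) = msoType K' q (Fin.elim0 : Fin 0 → Set K'.V) := by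
  refine h.msoType_eq q h' ?_ fun i => i.elim0
  convert ha using 2

end IsGluing

/-- If gluing `Γ 1` to `Γ 2` does not change the type of `Γ 2`, then neither does gluing any number
of copies. -/
theorem msoType_delta_replicate {q : ℕ} (Γ : PumpLetter → BiboundariedGraph ℓ)
    (h : msoType ((Γ .two).glue (Γ .one)) q (Fin.elim0 : Fin 0 → Set _) =
      msoType (Γ .two) q (Fin.elim0 : Fin 0 → Set _)) (n : ℕ) :
    msoType (Delta Γ .two (List.replicate n .one)) q (Fin.elim0 : Fin 0 → Set _) =
      msoType (Γ .two) q (Fin.elim0 : Fin 0 → Set _) := by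
  induction n with
  | zero => rfl
  | succ n ih =>
    rw [List.replicate_succ', Delta_append_singleton]
    exact ((isGluing_glue _ _).msoType_elim0_eq (isGluing_glue _ _) ih).trans h

/-- The induced subgraph on `A`, with primary ports `s` and secondary ports `t`. -/
def induced (M : FinDigraph) (A : Set M.V) (s t : Fin ℓ ↪ M.V) (hs : ∀ i, s i ∈ A)
    (ht : ∀ i, t i ∈ A) : BiboundariedGraph ℓ where
  V := A
  graph := { Adj := fun x y => M.graph.Adj x y }
  P₁ := s.codRestrict A hs
  P₂ := t.codRestrict A ht

/-- Two induced subgraphs that overlap in the merged ports and contain every edge of `K` are glued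
to `K`. The graph `K` is given by an embedding `c` into `M`, and `a`, `b` are the inclusions. -/
theorem isGluing_induced {M : FinDigraph} {A B : Set M.V} {s₀ s t : Fin ℓ ↪ M.V}
    (hs₀ : ∀ i, s₀ i ∈ A) (hsA : ∀ i, s i ∈ A) (hsB : ∀ i, s i ∈ B) (ht : ∀ i, t i ∈ B)
    (hAB : A ∩ B ⊆ Set.range s) (K : BiboundariedGraph ℓ) (c : K.V → M.V)
    (hc : Function.Injective c) (hK : ∀ z w, K.graph.Adj z w ↔ M.graph.Adj (c z) (c w))
    (hedge : ∀ z w, K.graph.Adj z w → c z ∈ A ∧ c w ∈ A ∨ c z ∈ B ∧ c w ∈ B)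
    (hcov : ∀ z, c z ∈ A ∨ c z ∈ B) (ht' : ∀ i, c (K.P₂ i) = t i)
    (a : A → K.V) (b : B → K.V) (ha : ∀ x, c (a x) = x) (hb : ∀ y, c (b y) = y) :
    IsGluing (induced M A s₀ s hs₀ hsA) (induced M B s t hsB ht) K a b where
  cover z := (hcov z).imp (fun h => ⟨⟨c z, h⟩, hc (ha _)⟩) fun h => ⟨⟨c z, h⟩, hc (hb _)⟩
  injective_left x y h := Subtype.ext ((ha x).symm.trans ((congrArg c h).trans (ha y)))
  injective_right x y h := Subtype.ext ((hb x).symm.trans ((congrArg c h).trans (hb y)))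
  eq_iff x y := by
    constructor
    · intro h
      have hxy : x.1 = y.1 := (ha x).symm.trans ((congrArg c h).trans (hb y))
      obtain ⟨i, hi⟩ := hAB ⟨x.2, hxy ▸ y.2⟩
      exact ⟨i, Subtype.ext hi.symm, Subtype.ext (hxy.symm.trans hi.symm)⟩
    · rintro ⟨i, rfl, rfl⟩
      exact hc ((ha ⟨s i, hsA i⟩).trans (hb ⟨s i, hsB i⟩).symm)
  adj_iff z w := by
    constructor
    · intro h
      have h' := (hK z w).1 h
      refine (hedge z w h).imp (fun ⟨hz, hw⟩ => ?_) fun ⟨hz, hw⟩ => ?_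
      · exact ⟨⟨c z, hz⟩, ⟨c w, hw⟩, h', hc (ha _), hc (ha _)⟩
      · exact ⟨⟨c z, hz⟩, ⟨c w, hw⟩, h', hc (hb _), hc (hb _)⟩
    · rintro (⟨x, y, hxy, rfl, rfl⟩ | ⟨x, y, hxy, rfl, rfl⟩)
      · refine (hK _ _).2 ?_
        rwa [ha x, ha y]
      · refine (hK _ _).2 ?_
        rwa [hb x, hb y]
  port i := hc ((ht' i).trans (hb ⟨t i, ht i⟩).symm)

end BiboundariedGraph

/-! ### Chains of separations from a tree decomposition -/

/-- The pair `x = (L, R)` is a separation of order at most `r`: the sides `L` and `R` cover the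
graph, each edge lies in one of them, and they share at most `r` vertices. -/
structure IsSeparation {V : Type} (G : Digraph V) (r : ℕ) (x : Set V × Set V) : Prop where
  cover : ∀ v, v ∈ x.1 ∨ v ∈ x.2
  edge : ∀ u v, G.Adj u v → u ∈ x.1 ∧ v ∈ x.1 ∨ u ∈ x.2 ∧ v ∈ x.2
  order : (x.1 ∩ x.2).ncard ≤ r

namespace TreeDecomposition

variable {V : Type} {G : Digraph V} (D : TreeDecomposition G)

/-- `X` is a union of connected components of the tree without the node `p`. -/
def IsBranch (p : D.Node) (X : Set D.Node) : Prop :=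
  p ∉ X ∧ ∀ q ∈ X, ∀ q', D.tree.Adj q q' → q' ∈ X ∨ q' = p

/-- The vertices in the bags outside `X`. -/
def outer (X : Set D.Node) : Set V := {v | ∃ q, q ∉ X ∧ v ∈ D.bag q}

/-- The vertices in the bag of `p` and in the bags inside `X`. -/
def inner (p : D.Node) (X : Set D.Node) : Set V := {v | ∃ q ∈ insert p X, v ∈ D.bag q}

variable {D}

/-- A walk that leaves a branch at `p` passes through `p`. -/
theorem IsBranch.mem_support {p : D.Node} {X : Set D.Node} (h : D.IsBranch p X) {x y : D.Node}
    (w : D.tree.Walk x y) (hx : x ∈ X) (hy : y ∉ X) : p ∈ w.support := by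
  induction w with
  | nil => exact absurd hx hy
  | @cons x z y hxz w ih =>
    rw [SimpleGraph.Walk.support_cons, List.mem_cons]
    obtain hz | rfl := h.2 x hx z hxz
    · exact .inr (ih hz hy)
    · exact .inr w.start_mem_support

theorem IsBranch.exists_adj {p : D.Node} {X : Set D.Node} (h : D.IsBranch p X)
    (hX : X.Nonempty) : ∃ c ∈ X, D.tree.Adj p c := by
  obtain ⟨x, hx⟩ := hX
  obtain ⟨w⟩ := D.isTree.connected.preconnected x p
  have key : ∀ {x y : D.Node} (w : D.tree.Walk x y), x ∈ X → y = p →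
      ∃ c ∈ X, D.tree.Adj p c := by
    intro x y w
    induction w with
    | nil => rintro hx rfl; exact absurd hx h.1
    | @cons x z y hxz w ih =>
      intro hx hy
      obtain hz | rfl := h.2 x hx z hxz
      · exact ih hz hy
      · exact ⟨x, hx, hxz.symm⟩
  exact key w hx rfl

theorem IsBranch.isSeparation {p : D.Node} {X : Set D.Node} (h : D.IsBranch p X) {r : ℕ}
    (hr : ∀ p, (D.bag p).card ≤ r) : IsSeparation G r (D.outer X, D.inner p X) where
  cover v := by
    obtain ⟨q, hq⟩ := D.vertex_mem v
    by_cases hqX : q ∈ X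
    · exact .inr ⟨q, .inr hqX, hq⟩
    · exact .inl ⟨q, hqX, hq⟩
  edge u v huv := by
    obtain ⟨q, hu, hv⟩ := D.edge_mem u v huv
    by_cases hqX : q ∈ X
    · exact .inr ⟨⟨q, .inr hqX, hu⟩, ⟨q, .inr hqX, hv⟩⟩
    · exact .inl ⟨⟨q, hqX, hu⟩, ⟨q, hqX, hv⟩⟩
  order := by
    classical
    have hsub : D.outer X ∩ D.inner p X ⊆ (D.bag p : Set V) := by
      rintro v ⟨⟨y, hyX, hy⟩, ⟨x, rfl | hxX, hx⟩⟩
      · exact hx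
      · obtain ⟨w⟩ := D.isTree.connected.preconnected x y
        exact D.path_mem x p y w.bypass w.bypass_isPath
          (h.mem_support w.bypass hxX hyX) v hx hy
    calc (D.outer X ∩ D.inner p X).ncard ≤ (D.bag p : Set V).ncard :=
          Set.ncard_le_ncard hsub (D.bag p).finite_toSet
      _ ≤ r := by rw [Set.ncard_coe_finset]; exact hr p

theorem outer_subset_outer {X X' : Set D.Node} (h : X' ⊆ X) : D.outer X ⊆ D.outer X' :=
  fun _ ⟨q, hq, hv⟩ => ⟨q, fun hq' => hq (h hq'), hv⟩

theorem inner_subset_inner {p p' : D.Node} {X X' : Set D.Node} (h : X' ⊆ X)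
    (hp : p' ∈ insert p X) : D.inner p' X' ⊆ D.inner p X := by
  rintro v ⟨q, rfl | hq, hv⟩
  exacts [⟨q, hp, hv⟩, ⟨q, .inr (h hq), hv⟩]

/-- A branch contains a strictly smaller one with at least about half of its vertices: if the branch
is connected, move `p` to its only neighbour there; otherwise, split the branch at `p`. -/
theorem IsBranch.exists_ssubset [Finite V] {p : D.Node} {X : Set D.Node} (h : D.IsBranch p X)
    (hX : X.Nonempty) {r : ℕ} (hr : ∀ p, (D.bag p).card ≤ r) :
    ∃ p' X', D.IsBranch p' X' ∧ X' ⊂ X ∧ p' ∈ insert p X ∧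
      (D.inner p X).ncard ≤ 2 * (D.inner p' X').ncard + r := by
  classical
  obtain ⟨c, hcX, hpc⟩ := h.exists_adj hX
  -- the connected component of `c` in the tree without `p`
  let Y : Set D.Node := {q | ∃ w : D.tree.Walk c q, p ∉ w.support}
  have hcp : p ≠ c := fun e => h.1 (e ▸ hcX)
  have hcY : c ∈ Y := ⟨.nil, by simpa using hcp⟩
  have hYX : Y ⊆ X := by
    rintro q ⟨w, hw⟩
    by_contra hq
    exact hw (h.mem_support w hcX hq)
  have hYadj : ∀ q ∈ Y, ∀ q', D.tree.Adj q q' → q' ∈ Y ∨ q' = p := by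
    rintro q ⟨w, hw⟩ q' hqq'
    by_cases hq' : q' = p
    · exact .inr hq'
    · refine .inl ⟨w.concat hqq', ?_⟩
      simp only [SimpleGraph.Walk.support_concat, List.mem_append,
        List.mem_singleton, not_or]
      exact ⟨hw, fun e => hq' e.symm⟩
  have hY : D.IsBranch p Y := ⟨fun hp => h.1 (hYX hp), hYadj⟩
  by_cases hXY : X ⊆ Y
  · -- two neighbours of `p` in the component would close a cycle
    have huniq : ∀ q ∈ X, D.tree.Adj q p → q = c := by
      intro q hq hqp
      by_contra hqc
      obtain ⟨w, hw⟩ := hXY hq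
      have hpath : (SimpleGraph.Walk.cons hpc.symm
          (SimpleGraph.Walk.cons hqp.symm SimpleGraph.Walk.nil)).IsPath := by
        simp [SimpleGraph.Walk.cons_isPath_iff, hcp.symm, hqp.ne.symm, Ne.symm hqc]
      have := congrArg Subtype.val
        ((D.isTree.isAcyclic.subsingleton_path c q).elim ⟨_, w.bypass_isPath⟩ ⟨_, hpath⟩)
      have hmem : p ∈ w.bypass.support := by
        rw [show w.bypass = _ from this]; simp
      exact hw (w.support_bypass_subset_support hmem)
    refine ⟨c, X \ {c}, ⟨fun hc => hc.2 rfl, ?_⟩, ?_, .inr hcX, ?_⟩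
    · rintro q ⟨hq, hqc⟩ q' hqq'
      by_cases hq'c : q' = c
      · exact .inr hq'c
      · refine .inl ⟨?_, hq'c⟩
        obtain hq' | rfl := h.2 q hq q' hqq'
        · exact hq'
        · exact absurd (huniq q hq hqq') hqc
    · exact ⟨Set.sdiff_subset, fun hsub => (hsub hcX).2 rfl⟩
    · have hsub : D.inner p X ⊆ (D.bag p : Set V) ∪ D.inner c (X \ {c}) := by
        rintro v ⟨q, rfl | hq, hv⟩
        · exact .inl hv
        · refine .inr ⟨q, ?_, hv⟩
          by_cases hqc : q = c
          · exact .inl hqc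
          · exact .inr ⟨hq, hqc⟩
      have h1 := (Set.ncard_le_ncard hsub (Set.toFinite _)).trans (Set.ncard_union_le _ _)
      rw [Set.ncard_coe_finset] at h1
      have := hr p
      omega
  · have hZ : D.IsBranch p (X \ Y) := by
      refine ⟨fun hp => h.1 hp.1, ?_⟩
      rintro q ⟨hq, hqY⟩ q' hqq'
      obtain hq' | rfl := h.2 q hq q' hqq'
      · refine .inl ⟨hq', fun hq'Y => ?_⟩
        obtain hq | rfl := hYadj q' hq'Y q hqq'.symm
        · exact hqY hq
        · exact h.1 hq
      · exact .inr rfl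
    have hsub : D.inner p X ⊆ D.inner p Y ∪ D.inner p (X \ Y) := by
      rintro v ⟨q, rfl | hq, hv⟩
      · exact .inl ⟨q, .inl rfl, hv⟩
      · by_cases hqY : q ∈ Y
        · exact .inl ⟨q, .inr hqY, hv⟩
        · exact .inr ⟨q, .inr ⟨hq, hqY⟩, hv⟩
    have h1 := (Set.ncard_le_ncard hsub (Set.toFinite _)).trans (Set.ncard_union_le _ _)
    obtain hle | hle := le_total (D.inner p Y).ncard (D.inner p (X \ Y)).ncard
    · exact ⟨p, X \ Y, hZ, ⟨Set.sdiff_subset, fun hs => (hs hcX).2 hcY⟩, .inl rfl, by omega⟩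
    · exact ⟨p, Y, hY, ⟨hYX, hXY⟩, .inl rfl, by omega⟩

/-- The number of vertices beyond which a chain of `N` separations of order at most `r` exists. -/
def chainBound (r : ℕ) : ℕ → ℕ
  | 0 => r
  | N + 1 => 2 * chainBound r N + r

/-- Inside a branch with many vertices there is a long strictly decreasing chain of separations. -/
theorem IsBranch.exists_chain [Finite V] {r : ℕ} (hr : ∀ p, (D.bag p).card ≤ r) (N : ℕ)
    {p : D.Node} {X : Set D.Node} (h : D.IsBranch p X)
    (hN : chainBound r N < (D.inner p X).ncard) :
    ∃ l : List (Set V × Set V), l.length = N ∧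
      l.Pairwise (fun x y => x.1 ⊆ y.1 ∧ y.2 ⊂ x.2) ∧
      ∀ x ∈ l, IsSeparation G r x ∧ D.outer X ⊆ x.1 ∧ x.2 ⊆ D.inner p X := by
  induction N generalizing p X with
  | zero => exact ⟨[], rfl, .nil, by simp⟩
  | succ N ihN =>
    induction hn : X.ncard using Nat.strong_induction_on generalizing p X with
    | _ n ihX =>
      subst hn
      have hX : X.Nonempty := by
        by_contra hX
        rw [Set.not_nonempty_iff_eq_empty] at hX
        subst hX
        have : D.inner p ∅ ⊆ (D.bag p : Set V) := by
          rintro v ⟨q, rfl | hq, hv⟩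
          · exact hv
          · exact absurd hq (Set.notMem_empty q)
        have h1 := Set.ncard_le_ncard this (Set.toFinite _)
        rw [Set.ncard_coe_finset] at h1
        have := hr p
        simp only [chainBound] at hN
        omega
      obtain ⟨p', X', h', hss, hp', hle⟩ := h.exists_ssubset hX hr
      have hout := outer_subset_outer hss.1
      have hin := inner_subset_inner hss.1 hp'
      by_cases hbig : chainBound r (N + 1) < (D.inner p' X').ncard
      · obtain ⟨l, hl, hpw, hsep⟩ := ihX _ (Set.ncard_lt_ncard hss (Set.toFinite _)) h' hbig rfl
        exact ⟨l, hl, hpw, fun x hx => ⟨(hsep x hx).1, hout.trans (hsep x hx).2.1,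
          (hsep x hx).2.2.trans hin⟩⟩
      · have hN' : chainBound r N < (D.inner p' X').ncard := by
          simp only [chainBound] at hN
          omega
        obtain ⟨l, hl, hpw, hsep⟩ := ihN h' hN'
        -- only the larger branch exceeds the bound for `N + 1`
        have hstrict : D.inner p' X' ⊂ D.inner p X :=
          ⟨hin, fun hsub => hbig (hN.trans_le (Set.ncard_le_ncard hsub (Set.toFinite _)))⟩
        refine ⟨(D.outer X, D.inner p X) :: l, by simp [hl], List.pairwise_cons.2
          ⟨fun x hx => ⟨hout.trans (hsep x hx).2.1, (hsep x hx).2.2.trans_ssubset hstrict⟩, hpw⟩,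
          ?_⟩
        intro x hx
        obtain rfl | hx := List.mem_cons.1 hx
        · exact ⟨h.isSeparation hr, subset_rfl, subset_rfl⟩
        · exact ⟨(hsep x hx).1, hout.trans (hsep x hx).2.1, (hsep x hx).2.2.trans hin⟩

theorem card_bag_le_of_width_eq {k : ℕ} (h : D.width = k) (p : D.Node) :
    (D.bag p).card ≤ k + 1 := by
  have := Finset.le_sup (f := fun p => (D.bag p).card) (Finset.mem_univ p)
  unfold width at h
  omega

theorem exists_chain_of_card_lt [Finite V] {k : ℕ} (h : D.width = k) {N : ℕ}
    (hN : chainBound (k + 1) N < Nat.card V) :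
    ∃ l : List (Set V × Set V), l.length = N ∧
      l.Pairwise (fun x y => x.1 ⊆ y.1 ∧ y.2 ⊂ x.2) ∧ ∀ x ∈ l, IsSeparation G (k + 1) x := by
  obtain ⟨p⟩ := D.isTree.connected.nonempty
  have hbranch : D.IsBranch p {p}ᶜ :=
    ⟨fun hp => hp rfl, fun _ _ q' _ => (Classical.em (q' = p)).symm⟩
  have huniv : D.inner p {p}ᶜ = Set.univ := by
    refine Set.eq_univ_of_forall fun v => ?_
    obtain ⟨q, hq⟩ := D.vertex_mem v
    exact ⟨q, Classical.em (q = p), hq⟩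
  obtain ⟨l, hl, hpw, hsep⟩ := hbranch.exists_chain (card_bag_le_of_width_eq h) N
    (by rwa [huniv, Set.ncard_univ])
  exact ⟨l, hl, hpw, fun x hx => (hsep x hx).1⟩

end TreeDecomposition

/-! ### Large models -/

/-- There are only finitely many digraphs of bounded size up to isomorphism. -/
theorem exists_isomorphic_of_card_le {M : ℕ → FinDigraph} {b : ℕ}
    (h : ∀ i, Nat.card (M i).V ≤ b) : ∃ i j, i ≠ j ∧ (M i).Isomorphic (M j) := by
  let e : ∀ i, (M i).V ≃ Fin (Nat.card (M i).V) := fun i => Finite.equivFin _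
  let f : ℕ → Σ n : Fin (b + 1), (Fin n → Fin n → Prop) := fun i =>
    ⟨⟨Nat.card (M i).V, Nat.lt_succ_of_le (h i)⟩,
      fun x y => (M i).graph.Adj ((e i).symm x) ((e i).symm y)⟩
  -- each graph is isomorphic to its code, whose size is read off the code itself
  have hf : ∀ i, ∃ g : (M i).V ≃ Fin (f i).1,
      ∀ x y, (M i).graph.Adj x y ↔ (f i).2 (g x) (g y) := fun i => ⟨e i, fun x y => by simp [f]⟩
  obtain ⟨i, j, hij, hfij⟩ := Finite.exists_ne_map_eq_of_infinite f
  obtain ⟨g, hg⟩ := hf i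
  obtain ⟨g', hg'⟩ := hf j
  generalize f i = t at hfij g hg
  subst hfij
  exact ⟨i, j, hij, ⟨⟨g.trans g'.symm, fun {x y} => by rw [hg, hg']; simp⟩⟩⟩

/-! ### Pumping -/

/-- The left side of the separation `x`, with the shared vertices as ports in some order, has the
order and the type that `c` prescribes. -/
def HasLeftType (M : FinDigraph) (q : ℕ) {r : ℕ} (x : Set M.V × Set M.V)
    (c : Σ ℓ : Fin r, MSOType ℓ q 0) : Prop :=
  ∃ (s : Fin c.1 ↪ M.V) (_ : Set.range s = x.1 ∩ x.2) (hs : ∀ i, s i ∈ x.1),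
    (BiboundariedGraph.induced M x.1 s s hs hs).msoType q (Fin.elim0 : Fin 0 → Set _) = c.2

theorem IsSeparation.exists_hasLeftType {M : FinDigraph} {r : ℕ} {x : Set M.V × Set M.V}
    (h : IsSeparation M.graph r x) (q : ℕ) :
    ∃ c : Σ ℓ : Fin (r + 1), MSOType ℓ q 0, HasLeftType M q x c := by
  let e := Finite.equivFin (x.1 ∩ x.2 : Set M.V)
  let s : Fin (x.1 ∩ x.2).ncard ↪ M.V := e.symm.toEmbedding.trans (Function.Embedding.subtype _)
  have hs : Set.range s = x.1 ∩ x.2 := by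
    ext v
    exact ⟨by rintro ⟨i, rfl⟩; exact (e.symm i).2, fun hv => ⟨e ⟨v, hv⟩, congrArg Subtype.val (e.symm_apply_apply _)⟩⟩
  have hs' : ∀ i, s i ∈ x.1 := fun i => (hs.subset (Set.mem_range_self i)).1
  exact ⟨⟨⟨_, Nat.lt_succ_of_le h.order⟩,
    (BiboundariedGraph.induced M x.1 s s hs' hs').msoType q Fin.elim0⟩, s, hs, hs', rfl⟩

open BiboundariedGraph in
/-- Two nested separations whose left sides have the same type allow pumping of the part between
them. -/
theorem exists_pump {M : FinDigraph} {φ : MSOSentence} (hM : M.Models φ) {r r' : ℕ}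
    {x y : Set M.V × Set M.V} (hx : IsSeparation M.graph r x) (hy : IsSeparation M.graph r y)
    (hxy : x.1 ⊆ y.1) (hyx : y.2 ⊂ x.2) {c : Σ ℓ : Fin r', MSOType ℓ φ.rank 0}
    (hcx : HasLeftType M φ.rank x c) (hcy : HasLeftType M φ.rank y c) :
    ∃ Γ : PumpLetter → BiboundariedGraph c.1,
      Set.range (Γ .one).P₁ ∩ Set.range (Γ .one).P₂ ≠ Set.univ ∧
      ∀ n : ℕ, (Delta Γ .two
        (List.replicate n .one ++ [.three])).toFinDigraph.Models φ := by
  obtain ⟨s, hs, hsx, hcx⟩ := hcx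
  obtain ⟨t, ht, hty, hcy⟩ := hcy
  have hsx2 : ∀ i, s i ∈ x.2 := fun i => (hs.subset (Set.mem_range_self i)).2
  have hty2 : ∀ i, t i ∈ y.2 := fun i => (ht.subset (Set.mem_range_self i)).2
  have hsB : ∀ i, s i ∈ x.2 ∩ y.1 := fun i => ⟨hsx2 i, hxy (hsx i)⟩
  have htB : ∀ i, t i ∈ x.2 ∩ y.1 := fun i => ⟨hyx.1 (hty2 i), hty i⟩
  let Γ : PumpLetter → BiboundariedGraph c.1
    | .one => induced M (x.2 ∩ y.1) s t hsB htB
    | .two => induced M x.1 s s hsx hsx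
    | .three => induced M y.2 t t hty2 hty2
  have glue₁ : IsGluing (Γ .two) (Γ .one) (induced M y.1 t t hty hty)
      (Set.inclusion hxy) (Set.inclusion Set.inter_subset_right) := by
    refine isGluing_induced _ _ _ _ ?_ _ Subtype.val Subtype.val_injective (fun _ _ => Iff.rfl)
      (fun z w hzw => ?_) (fun z => ?_) (fun _ => rfl) _ _ (fun _ => rfl) (fun _ => rfl)
    · exact fun v hv => hs.symm.subset ⟨hv.1, hv.2.1⟩
    · exact (hx.edge z.1 w.1 hzw).imp id fun h => ⟨⟨h.1, z.2⟩, ⟨h.2, w.2⟩⟩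
    · exact (hx.cover z.1).imp id fun h => ⟨h, z.2⟩
  let K : BiboundariedGraph c.1 := { M with P₁ := t, P₂ := t }
  have glue₂ : IsGluing (induced M y.1 t t hty hty) (Γ .three) K Subtype.val Subtype.val :=
    isGluing_induced _ _ _ _ ht.symm.subset K id Function.injective_id (fun _ _ => Iff.rfl)
      (fun z w hzw => hy.edge z w hzw) hy.cover (fun _ => rfl) _ _ (fun _ => rfl) fun _ => rfl
  have htwo : msoType ((Γ .two).glue (Γ .one)) φ.rank (Fin.elim0 : Fin 0 → Set _) =
      msoType (Γ .two) φ.rank (Fin.elim0 : Fin 0 → Set _) :=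
    ((isGluing_glue _ _).msoType_elim0_eq glue₁ rfl).trans (hcy.trans hcx.symm)
  refine ⟨Γ, fun huniv => hyx.2 fun v hv => ?_, fun n => ?_⟩
  · -- a vertex of `x.2` outside `y.2` lies between the separations and is no port of `y`
    by_contra hvy
    have hvB : v ∈ x.2 ∩ y.1 := ⟨hv, (hy.cover v).resolve_right hvy⟩
    obtain ⟨i, hi⟩ := (huniv.symm.subset (Set.mem_univ (⟨v, hvB⟩ : (Γ .one).V))).2
    have : t i = v := congrArg Subtype.val hi
    exact hvy (this ▸ hty2 i)
  · rw [Delta_append_singleton]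
    refine (models_iff_of_msoType_eq φ ((isGluing_glue _ _).msoType_elim0_eq glue₂ ?_)).2
      (show K.toFinDigraph.Models φ from hM)
    exact (msoType_delta_replicate Γ htwo n).trans (hcx.trans hcy.symm)

theorem proposition7 (φ : MSOSentence) (k : ℕ)
    (hφ : InfinitelyManyModelsOfTreewidth φ (k : ℤ)) :
    ∃ ℓ : ℕ, ℓ ≤ k + 1 ∧ ∃ Γ : PumpLetter → BiboundariedGraph ℓ,
      Set.range (Γ .one).P₁ ∩ Set.range (Γ .one).P₂ ≠ Set.univ ∧
      ∀ n : ℕ, (BiboundariedGraph.Delta Γ .two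
        (List.replicate n .one ++ [.three])).toFinDigraph.Models φ := by
  obtain ⟨M, hM, hiso⟩ := hφ
  let C := Σ ℓ : Fin (k + 1 + 1), MSOType ℓ φ.rank 0
  -- a chain with more separations than there are types
  let N := Nat.card C + 1
  obtain ⟨i, hi⟩ : ∃ i, TreeDecomposition.chainBound (k + 1) N < Nat.card (M i).V := by
    by_contra! hle
    obtain ⟨i, j, hij, h⟩ := exists_isomorphic_of_card_le hle
    exact hiso i j hij h
  obtain ⟨hmodel, ⟨D, hD⟩, -⟩ := hM i
  obtain ⟨l, hl, hpw, hsep⟩ := D.exists_chain_of_card_lt hD hi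
  choose c hc using fun a : Fin l.length =>
    (hsep (l.get a) (l.get_mem a)).exists_hasLeftType φ.rank
  obtain ⟨a, b, hne, hab⟩ : ∃ a b, a ≠ b ∧ c a = c b := by
    by_contra! hinj
    have := Nat.card_le_card_of_injective c fun a b hab => by_contra fun hne => hinj a b hne hab
    rw [Nat.card_fin, hl] at this
    exact absurd this (Nat.not_succ_le_self _)
  wlog hlt : a < b generalizing a b
  · exact this b a hne.symm hab.symm (lt_of_le_of_ne (not_lt.1 hlt) hne.symm)
  have hrel := List.pairwise_iff_get.1 hpw a b hlt
  exact ⟨(c a).1, Nat.lt_succ_iff.1 (c a).1.2, exists_pump hmodel (hsep _ (l.get_mem a))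
    (hsep _ (l.get_mem b)) hrel.1 hrel.2 (hc a) (hab ▸ hc b)⟩
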